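/- Let $\mathfrak R$ be a complete, separated topological associative unital ring in which open right ideals form a base of neighborhoods of zero. For a set $X$, let $\mathfrak R[[X]]$ denote the set of all formal linear combinations $\sum_{x\in X}r_xx$ whose coefficients $r_x\in\mathfrak R$ converge to zero, i.e. for every open right ideal $\mathfrak I\subset\mathfrak R$ one has $r_x\in\mathfrak I$ for all but finitely many $x\in X$. The functor $X\mapsto\mathfrak R[[X]]$ is a monad on the category of sets, with the unit $x\mapsto 1\cdot x$ and the multiplication $\mathfrak R[[\mathfrak R[[X]]]]\to\mathfrak R[[X]]$ given by opening parentheses. Left $\mathfrak R$-contramodules are the algebras over this monad; they form an abelian category $\mathfrak R\text{-}\mathrm{contra}$ with enough projective objects. A right $\mathfrak R$-module $\mathcal N$ is discrete if the annihilator of each of its elements is open in $\mathfrak R$. For a discrete right $\mathfrak R$-module $\mathcal N$ and a left $\mathfrak R$-contramodule $\mathfrak C$ with the contraaction map $\pi\colon\mathfrak R[[\mathfrak C]]\to\mathfrak C$, the contratensor product $\mathcal N\odot_{\mathfrak R}\mathfrak C$ is the quotient group of $\mathcal N\otimes_{\mathbb Z}\mathfrak C$ by the subgroup generated by all elements $b\otimes\pi\bigl(\sum_{c}r_cc\bigr)-\sum_{c}br_c\otimes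 c$ with $b\in\mathcal N$ and $\sum_{c}r_cc\in\mathfrak R[[\mathfrak C]]$. Let $\mathrm{Ctrtor}_i^{\mathfrak R}(\mathcal N,-)$, $i\ge0$, be the left derived functors of $\mathcal N\odot_{\mathfrak R}-\colon\mathfrak R\text{-}\mathrm{contra}\to\mathbb Z\text{-}\mathrm{mod}$. A left $\mathfrak R$-contramodule $\mathfrak F$ is $\infty$-strictly flat if $\mathrm{Ctrtor}_i^{\mathfrak R}(\mathcal N,\mathfrak F)=0$ for all discrete right $\mathfrak R$-modules $\mathcal N$ and all $i\ge1$. (a) Let $J$ be a nonempty countable directed preordered set and let $(\mathfrak P_j)_{j\in J}$ be a $J$-indexed direct system of projective left $\mathfrak R$-contramodules. Then the direct limit $\varinjlim_{j\in J}\mathfrak P_j$ in $\mathfrak R\text{-}\mathrm{contra}$ exists, has projective dimension at most $1$ in $\mathfrak R\text{-}\mathrm{contra}$, and is $\infty$-strictly flat. (b) In particular, for any sequence of elements $a_1,a_2,a_3,\ldots$ of $\mathfrak R$, the Bass flat left $\mathfrak R$-contramodule $$\mathfrak B=\varinjlim\bigl(\mathfrak R\xrightarrow{*a_1}\mathfrak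 R\xrightarrow{*a_2}\mathfrak R\xrightarrow{*a_3}\cdots\bigr),$$ where $\mathfrak R$ is viewed as the free left $\mathfrak R$-contramodule with one generator and $*a_n$ is right multiplication by $a_n$, exists, has projective dimension at most $1$ in $\mathfrak R\text{-}\mathrm{contra}$, and is $\infty$-strictly flat. -/

import Mathlib

open CategoryTheory CategoryTheory.Limits Filter Topology

universe u w

namespace Contra

noncomputable section

variable {R : Type u} [Ring R] [UniformSpace R]

/-- The group `R[[X]]` of infinite formal linear combinations `∑ r_x x` of elements of `X`, with
the coefficients `r_x` converging to zero in the topology of `R`. -/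
def convComb (R : Type u) [Ring R] [UniformSpace R] [IsUniformAddGroup R] (X : Type*) :
    AddSubgroup (X → R) where
  carrier := {r | Tendsto r cofinite (𝓝 0)}
  zero_mem' := tendsto_const_nhds
  add_mem' ha hb := by simpa only [add_zero] using! Tendsto.add ha hb
  neg_mem' ha := by simpa only [neg_zero] using! Tendsto.neg ha

variable [IsUniformAddGroup R]

/-- The point measure `1 · x`. -/
def point {X : Type*} (x : X) : convComb R X := by
  classical
  exact ⟨Pi.single x 1, tendsto_const_nhds.congr' (by
    have : ({x}ᶜ : Set X) ∈ cofinite := by simp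
    filter_upwards [this] with y hy
    simp only [Set.mem_compl_iff, Set.mem_singleton_iff] at hy
    simp [hy])⟩

theorem point_self {X : Type*} (x : X) : (point x : convComb R X).1 x = 1 := by simp [point]

theorem point_ne {X : Type*} {x y : X} (h : y ≠ x) : (point x : convComb R X).1 y = 0 := by
  simp [point, h]

variable [IsTopologicalRing R] [IsLinearTopology Rᵐᵒᵖ R] [CompleteSpace R]

instance (priority := 100) nonarchimedean : NonarchimedeanAddGroup R where
  is_nonarchimedean U hU := by
    obtain ⟨I, hI, hIU⟩ := (IsLinearTopology.hasBasis_open_submodule (M := R) Rᵐᵒᵖ).mem_iff.1 hU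
    exact ⟨⟨I.toAddSubgroup, hI⟩, hIU⟩

theorem summable_of_tendsto {X : Type*} {r : X → R} (h : Tendsto r cofinite (𝓝 0)) :
    Summable r := NonarchimedeanAddGroup.summable_of_tendsto_cofinite_zero h

theorem tendsto_mul_right {X : Type*} {r : X → R} (h : Tendsto r cofinite (𝓝 0)) (t : X → R) :
    Tendsto (fun x => r x * t x) cofinite (𝓝 0) :=
  IsLinearTopology.tendsto_smul_zero (R := Rᵐᵒᵖ) (fun x => MulOpposite.op (t x)) r h

theorem tendsto_mul_prod {X Y : Type*} (r : convComb R Y) (s : Y → convComb R X) :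
    Tendsto (fun p : Y × X => r.1 p.1 * (s p.1).1 p.2) cofinite (𝓝 0) := by
  rw [(IsLinearTopology.hasBasis_open_submodule (M := R) Rᵐᵒᵖ).tendsto_right_iff]
  intro I hI
  have hI0 : (I : Set R) ∈ 𝓝 (0 : R) := hI.mem_nhds I.zero_mem
  have h1 : {y | ¬ r.1 y ∈ I}.Finite := r.2 hI0
  have h2 : ∀ y, {x | ¬ r.1 y * (s y).1 x ∈ I}.Finite := fun y => by
    have : Tendsto (fun x => r.1 y * (s y).1 x) cofinite (𝓝 0) := by
      simpa using Tendsto.const_mul (r.1 y) (s y).2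
    exact this hI0
  refine ((h1.biUnion fun y _ => (h2 y).image (Prod.mk y)).subset ?_)
  rintro ⟨y, x⟩ hp
  have hp : ¬ r.1 y * (s y).1 x ∈ I := hp
  have hy : ¬ r.1 y ∈ I := fun h => hp (I.smul_mem (MulOpposite.op ((s y).1 x)) h)
  simp only [Set.mem_iUnion]
  exact ⟨y, hy, x, hp, rfl⟩

variable [T2Space R]

/-- Substitution: `∑ r_y y` and `y ↦ ∑ s_{y,x} x` are sent to `∑_x (∑_y r_y s_{y,x}) x`. -/
def bind {X Y : Type*} (r : convComb R Y) (s : Y → convComb R X) : convComb R X :=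
  ⟨fun x => ∑' y, r.1 y * (s y).1 x, by
    have h := (summable_of_tendsto (tendsto_mul_prod r s)).prod_symm
    exact h.prod.tendsto_cofinite_zero⟩

theorem bind_bind {X Y Z : Type*} (r : convComb R Z) (s : Z → convComb R Y)
    (t : Y → convComb R X) : bind (bind r s) t = bind r fun z => bind (s z) t := by
  ext x
  have h := summable_of_tendsto
    (tendsto_mul_right (tendsto_mul_prod r s) fun p => (t p.2).1 x)
  have h1 : ∀ y, Summable fun z => r.1 z * (s z).1 y := fun y =>
    (summable_of_tendsto (tendsto_mul_prod r s)).prod_symm.prod_factor y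
  have h2 : ∀ z, Summable fun y => (s z).1 y * (t y).1 x := fun z =>
    summable_of_tendsto (tendsto_mul_right (s z).2 _)
  change ∑' y, (∑' z, r.1 z * (s z).1 y) * (t y).1 x =
    ∑' z, r.1 z * ∑' y, (s z).1 y * (t y).1 x
  simp_rw [← (h1 _).tsum_mul_right, ← (h2 _).tsum_mul_left, ← mul_assoc]
  exact (Summable.tsum_comm (f := fun z y => r.1 z * (s z).1 y * (t y).1 x) h)

theorem bind_point {X : Type*} (r : convComb R X) : bind r point = r := by
  ext x
  change ∑' y, r.1 y * (point y : convComb R X).1 x = r.1 x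
  rw [tsum_eq_single x fun y hy => by rw [point_ne hy.symm, mul_zero], point_self, mul_one]

theorem point_bind {X Y : Type*} (y : Y) (s : Y → convComb R X) : bind (point y) s = s y := by
  ext x
  change ∑' z, (point y : convComb R Y).1 z * (s z).1 x = _
  rw [tsum_eq_single y fun z hz => by rw [point_ne hz, zero_mul], point_self, one_mul]

theorem bind_add {X Y : Type*} (r : convComb R Y) (s t : Y → convComb R X) :
    (bind r fun y => s y + t y) = bind r s + bind r t := by
  ext x
  change ∑' y, r.1 y * ((s y).1 x + (t y).1 x) = _
  simp_rw [mul_add]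
  exact (summable_of_tendsto (tendsto_mul_right r.2 _)).tsum_add
    (summable_of_tendsto (tendsto_mul_right r.2 _))

theorem add_bind {X Y : Type*} (r r' : convComb R Y) (s : Y → convComb R X) :
    bind (r + r') s = bind r s + bind r' s := by
  ext x
  change ∑' y, (r.1 y + r'.1 y) * (s y).1 x = _
  simp_rw [add_mul]
  exact (summable_of_tendsto (tendsto_mul_right r.2 _)).tsum_add
    (summable_of_tendsto (tendsto_mul_right r'.2 _))

/-- `bind r s` as an additive function of `r`. -/
def bindHom {X Y : Type*} (s : Y → convComb R X) : convComb R Y →+ convComb R X :=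
  AddMonoidHom.mk' (fun r => bind r s) fun r r' => add_bind r r' s

/-- The map `R[[f]] : R[[X]] → R[[Y]]`, `∑ r_x x ↦ ∑_y (∑_{f x = y} r_x) y`. -/
def map {X Y : Type*} (f : X → Y) (r : convComb R X) : convComb R Y :=
  ⟨fun y => ∑' x : f ⁻¹' {y}, r.1 x, by
    convert (bind r fun x => point (f x)).2 using 2 with y
    change _ = ∑' x, r.1 x * (point (f x) : convComb R Y).1 y
    rw [tsum_subtype]
    refine tsum_congr fun x => ?_
    by_cases h : f x = y
    · subst h; simp [point_self]
    · rw [point_ne (Ne.symm h)]; simp [h]⟩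

theorem map_eq_bind {X Y : Type*} (f : X → Y) (r : convComb R X) :
    map f r = bind r fun x => point (f x) := by
  ext y
  change ∑' x : f ⁻¹' {y}, r.1 x = ∑' x, r.1 x * (point (f x) : convComb R Y).1 y
  rw [tsum_subtype]
  refine tsum_congr fun x => ?_
  by_cases h : f x = y
  · subst h; simp [point_self]
  · rw [point_ne (Ne.symm h)]; simp [h]

/-- Opening of parentheses `R[[R[[X]]]] → R[[X]]`: the coefficient of the image of `∑ r_y y`
at `x` is `∑_y r_y y_x`. -/
def join {X : Type*} (r : convComb R (convComb R X)) : convComb R X :=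
  ⟨fun x => ∑' y, r.1 y * y.1 x, (bind r id).2⟩

theorem join_eq_bind {X : Type*} (r : convComb R (convComb R X)) : join r = bind r id := rfl

variable (R) in
/-- The monad `X ↦ R[[X]]` on the category of sets. -/
def contraMonad : Monad (Type u) where
  obj X := convComb R X
  map f := TypeCat.ofHom (map f)
  map_id X := by
    refine ConcreteCategory.hom_ext _ _ fun r => ?_
    exact (map_eq_bind _ _).trans (bind_point r)
  map_comp f g := by
    refine ConcreteCategory.hom_ext _ _ fun r => ?_
    change map (g ∘ f) r = map g (map f r)
    simp [map_eq_bind, bind_bind, point_bind]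
  η := { app X := TypeCat.ofHom point
         naturality X Y f := by
          refine ConcreteCategory.hom_ext _ _ fun x => ?_
          change point (f x) = map f (point x)
          simp [map_eq_bind, point_bind] }
  μ := { app X := TypeCat.ofHom join
         naturality X Y f := by
          refine ConcreteCategory.hom_ext _ _ fun r => ?_
          change join (map (map f) r) = map f (join r)
          simp [map_eq_bind, join_eq_bind, bind_bind, point_bind] }
  assoc X := by
    refine ConcreteCategory.hom_ext _ _ fun r => ?_
    change join (map join r) = join (join r)
    simp [map_eq_bind, join_eq_bind, bind_bind, point_bind]
  left_unit X := by
    refine ConcreteCategory.hom_ext _ _ fun r => ?_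
    change join (point r) = r
    simp [join_eq_bind, point_bind]
  right_unit X := by
    refine ConcreteCategory.hom_ext _ _ fun r => ?_
    change join (map point r) = r
    simp [map_eq_bind, join_eq_bind, bind_bind, point_bind]
    exact bind_point r

theorem map_map {X Y Z : Type*} (f : X → Y) (g : Y → Z) (r : convComb R X) :
    map g (map f r) = map (fun x => g (f x)) r := by
  simp [map_eq_bind, bind_bind, point_bind]

theorem map_point {X Y : Type*} (f : X → Y) (x : X) :
    map f (point x : convComb R X) = point (f x) := by
  simp [map_eq_bind, point_bind]

theorem map_bind {X Y Z : Type*} (f : X → Y) (r : convComb R Z) (s : Z → convComb R X) :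
    map f (bind r s) = bind r fun z => map f (s z) := by
  simp [map_eq_bind, bind_bind]

theorem bind_map {X Y Z : Type*} (f : Z → Y) (r : convComb R Z) (s : Y → convComb R X) :
    bind (map f r) s = bind r fun z => s (f z) := by
  simp [map_eq_bind, bind_bind, point_bind]

theorem map_id' {X : Type*} (r : convComb R X) : map (fun x => x) r = r := by
  rw [map_eq_bind]; exact bind_point r

theorem map_hom_eq {X Y : Type*} (f : X → Y) :
    (map f : convComb R X → convComb R Y) = bindHom fun x => point (f x) :=
  funext fun r => map_eq_bind f r

variable (R) in
/-- The category of left contramodules over `R`: algebras over the monad `X ↦ R[[X]]`. -/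
abbrev Contramodule := (contraMonad R).Algebra

/-- The contraaction map `R[[C]] → C`. -/
def act (C : Contramodule R) (r : convComb R C.A) : C.A := C.a r

theorem act_point (C : Contramodule R) (c : C.A) : act C (point c) = c :=
  ConcreteCategory.congr_hom C.unit c

theorem act_join (C : Contramodule R) (r : convComb R (convComb R C.A)) :
    act C (join r) = act C (map (act C) r) :=
  ConcreteCategory.congr_hom C.assoc r

theorem act_bind (C : Contramodule R) {X : Type u} (r : convComb R X)
    (s : X → convComb R C.A) : act C (bind r s) = act C (map (fun x => act C (s x)) r) := by
  have h := act_join C (map s r)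
  rw [join_eq_bind, bind_map, map_map] at h
  exact h

theorem hom_act {C D : Contramodule R} (f : C ⟶ D) (r : convComb R C.A) :
    f.f (act C r) = act D (map f.f r) :=
  (ConcreteCategory.congr_hom f.h r).symm

/-- A contramodule from a contraunital and contraassociative contraaction map. -/
def mkObj (C : Type u) (π : convComb R C → C) (h1 : ∀ c, π (point c) = c)
    (h2 : ∀ r, π (join r) = π (map π r)) : Contramodule R where
  A := C
  a := TypeCat.ofHom π
  unit := ConcreteCategory.hom_ext _ _ h1
  assoc := ConcreteCategory.hom_ext _ _ h2

/-- A contramodule morphism from a map commuting with the contraactions. -/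
def mkHom {C D : Contramodule R} (f : C.A → D.A)
    (h : ∀ r, f (act C r) = act D (map f r)) : C ⟶ D where
  f := TypeCat.ofHom f
  h := ConcreteCategory.hom_ext _ _ fun r => (h r).symm

theorem hom_ext {C D : Contramodule R} {f g : C ⟶ D} (h : ∀ c, f.f c = g.f c) : f = g :=
  Monad.Algebra.Hom.ext (ConcreteCategory.hom_ext _ _ h)

/-! The underlying abelian group of a contramodule. -/

instance (C : Contramodule R) : Zero C.A := ⟨act C 0⟩
instance (C : Contramodule R) : Add C.A := ⟨fun a b => act C (point a + point b)⟩
instance (C : Contramodule R) : Neg C.A := ⟨fun a => act C (-point a)⟩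
instance (C : Contramodule R) : Sub C.A := ⟨fun a b => act C (point a - point b)⟩
instance (C : Contramodule R) : SMul ℕ C.A := ⟨fun n a => act C (n • point a)⟩
instance (C : Contramodule R) : SMul ℤ C.A := ⟨fun n a => act C (n • point a)⟩

theorem act_map_act (C : Contramodule R) (t : convComb R (convComb R C.A)) :
    act C (bindHom (fun y => point (act C y)) t) = act C (bindHom id t) := by
  rw [← map_hom_eq, ← act_join]; rfl

theorem bindHom_point {X Y : Type*} (y : Y) (s : Y → convComb R X) :
    bindHom s (point y) = s y := point_bind y s

theorem act_add (C : Contramodule R) (r s : convComb R C.A) :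
    act C (r + s) = act C r + act C s := by
  have := act_map_act C (point r + point s)
  simpa only [map_add, bindHom_point] using! this.symm

theorem act_neg (C : Contramodule R) (r : convComb R C.A) : act C (-r) = -act C r := by
  have := act_map_act C (-point r)
  simpa only [map_neg, bindHom_point] using! this.symm

theorem act_sub (C : Contramodule R) (r s : convComb R C.A) :
    act C (r - s) = act C r - act C s := by
  have := act_map_act C (point r - point s)
  simpa only [map_sub, bindHom_point] using! this.symm

theorem act_nsmul (C : Contramodule R) (r : convComb R C.A) (n : ℕ) :
    act C (n • r) = n • act C r := by
  have := act_map_act C (n • point r)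
  simpa only [map_nsmul, bindHom_point] using! this.symm

theorem act_zsmul (C : Contramodule R) (r : convComb R C.A) (n : ℤ) :
    act C (n • r) = n • act C r := by
  have := act_map_act C (n • point r)
  simpa only [map_zsmul, bindHom_point] using! this.symm

theorem act_surjective (C : Contramodule R) : Function.Surjective (act C) :=
  fun c => ⟨point c, act_point C c⟩

instance (C : Contramodule R) : AddCommGroup C.A :=
  (act_surjective C).addCommGroup (act C) rfl (act_add C) (act_neg C) (act_sub C)
    (act_nsmul C) (act_zsmul C)

theorem act_zero (C : Contramodule R) : act C 0 = 0 := rfl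

theorem add_def (C : Contramodule R) (a b : C.A) : a + b = act C (point a + point b) := rfl

theorem act_map_add (C : Contramodule R) {X : Type u} (f g : X → C.A) (r : convComb R X) :
    act C (map (fun x => f x + g x) r) = act C (map f r) + act C (map g r) := by
  have h : act C (map (fun x => f x + g x) r) = act C (bind r fun x => point (f x) + point (g x)) :=
    (act_bind C r fun x => point (f x) + point (g x)).symm
  rw [h, bind_add, act_add, ← map_eq_bind, ← map_eq_bind]

theorem act_map_zero (C : Contramodule R) {X : Type u} (r : convComb R X) :
    act C (map (fun _ => (0 : C.A)) r) = 0 := by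
  have := act_map_add C (fun _ => (0 : C.A)) (fun _ => (0 : C.A)) r
  simpa using this

theorem act_map_neg (C : Contramodule R) {X : Type u} (f : X → C.A) (r : convComb R X) :
    act C (map (fun x => - f x) r) = - act C (map f r) := by
  have := act_map_add C (fun x => - f x) f r
  simp only [neg_add_cancel, act_map_zero] at this
  exact eq_neg_of_add_eq_zero_left this.symm

/-- The additive map underlying a contramodule morphism. -/
def homAdd {C D : Contramodule R} (f : C ⟶ D) : C.A →+ D.A :=
  AddMonoidHom.mk' (fun c => f.f c) fun a b => by
    change f.f (act C (point a + point b)) = act D (point (f.f a) + point (f.f b))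
    rw [hom_act, map_hom_eq, map_add, bindHom_point, bindHom_point]

theorem f_add {C D : Contramodule R} (f : C ⟶ D) (a b : C.A) : f.f (a + b) = f.f a + f.f b :=
  (homAdd f).map_add a b

instance (C D : Contramodule R) : Zero (C ⟶ D) :=
  ⟨mkHom (fun _ => 0) fun r => (act_map_zero D r).symm⟩
instance (C D : Contramodule R) : Add (C ⟶ D) :=
  ⟨fun f g => mkHom (fun c => f.f c + g.f c) fun r => by
    rw [act_map_add, hom_act, hom_act]⟩
instance (C D : Contramodule R) : Neg (C ⟶ D) :=
  ⟨fun f => mkHom (fun c => -f.f c) fun r => by rw [act_map_neg, hom_act]⟩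

instance (C D : Contramodule R) : AddCommGroup (C ⟶ D) where
  add_assoc f g h := hom_ext fun c => add_assoc (f.f c) (g.f c) (h.f c)
  zero_add f := hom_ext fun c => zero_add (f.f c)
  add_zero f := hom_ext fun c => add_zero (f.f c)
  add_comm f g := hom_ext fun c => add_comm (f.f c) (g.f c)
  neg_add_cancel f := hom_ext fun c => neg_add_cancel (f.f c)
  nsmul := nsmulRec
  zsmul := zsmulRec

instance : Preadditive (Contramodule R) where
  add_comp _ _ _ f f' g := hom_ext fun c => by
    change g.f (f.f c + f'.f c) = g.f (f.f c) + g.f (f'.f c)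
    exact f_add g _ _
  comp_add _ _ _ f g g' := rfl

/-! Cokernels, and the abelian category structure. -/

/-- The image of a contramodule morphism, as a subgroup. -/
def range {C D : Contramodule R} (f : C ⟶ D) : AddSubgroup D.A := (homAdd f).range

theorem act_map_mem_range {C D : Contramodule R} (f : C ⟶ D) {X : Type u} (g : X → D.A)
    (hg : ∀ x, g x ∈ range f) (r : convComb R X) : act D (map g r) ∈ range f := by
  choose h hh using hg
  refine ⟨act C (map h r), ?_⟩
  change f.f (act C (map h r)) = _
  rw [hom_act, map_map]
  congr 2
  exact funext hh

theorem mk_act_eq {C D : Contramodule R} (f : C ⟶ D) {X : Type u} (g g' : X → D.A)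
    (hg : ∀ x, (g x : D.A ⧸ range f) = g' x) (r : convComb R X) :
    (act D (map g r) : D.A ⧸ range f) = act D (map g' r) := by
  rw [QuotientAddGroup.eq, ← act_map_neg, ← act_map_add]
  exact act_map_mem_range f _ (fun x => QuotientAddGroup.eq.1 (hg x)) r

/-- The contraaction on the quotient by the image of a morphism. -/
def quotAct {C D : Contramodule R} (f : C ⟶ D)
    (r : convComb R (D.A ⧸ range f)) : D.A ⧸ range f :=
  (act D (map Quotient.out r) : D.A ⧸ range f)

theorem quotAct_map {C D : Contramodule R} (f : C ⟶ D) {X : Type u} (g : X → D.A)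
    (r : convComb R X) :
    quotAct f (map (fun x => (g x : D.A ⧸ range f)) r) = (act D (map g r) : D.A ⧸ range f) := by
  rw [quotAct, map_map]
  exact mk_act_eq f _ _ (fun x => Quotient.out_eq _) r

/-- The cokernel of a contramodule morphism. -/
def coker {C D : Contramodule R} (f : C ⟶ D) : Contramodule R :=
  mkObj (D.A ⧸ range f) (quotAct f)
    (fun c => by
      rw [quotAct, map_point, act_point]
      exact Quotient.out_eq _)
    fun r => by
      have h := quotAct_map f (fun s => act D (map Quotient.out s)) r
      change quotAct f (map (quotAct f) r) = _ at h
      rw [h, ← act_bind, quotAct, join_eq_bind, map_bind]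
      rfl

/-- The projection onto the cokernel. -/
def cokerπ {C D : Contramodule R} (f : C ⟶ D) : D ⟶ coker f :=
  mkHom (fun d => (d : D.A ⧸ range f)) fun r => by
    have := quotAct_map f (fun x => x) r
    rw [map_id'] at this
    exact this.symm

theorem zero_f {C D : Contramodule R} (c : C.A) : (0 : C ⟶ D).f c = 0 := rfl

theorem cokerπ_eq_zero {C D : Contramodule R} (f : C ⟶ D) (d : D.A) :
    (cokerπ f).f d = 0 ↔ d ∈ range f := by
  have h : (cokerπ f).f d = (cokerπ f).f 0 ↔ d ∈ range f :=
    (QuotientAddGroup.eq (s := range f)).trans (by rw [add_zero, neg_mem_iff])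
  rwa [show (cokerπ f).f 0 = 0 from (homAdd (cokerπ f)).map_zero] at h

theorem comp_cokerπ {C D : Contramodule R} (f : C ⟶ D) : f ≫ cokerπ f = 0 :=
  hom_ext fun c => (cokerπ_eq_zero f _).2 ⟨c, rfl⟩

/-- A morphism descends along a surjective morphism if it is compatible with its fibres. -/
def desc {C D E : Contramodule R} (f : C ⟶ D) (hf : Function.Surjective f.f) (g : C ⟶ E)
    (h : ∀ c, f.f c = 0 → g.f c = 0) : D ⟶ E :=
  have key : ∀ c, g.f (Function.surjInv hf (f.f c)) = g.f c := fun c => by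
    have h1 := h (Function.surjInv hf (f.f c) - c) (by
      have := (homAdd f).map_sub (Function.surjInv hf (f.f c)) c
      refine this.trans (sub_eq_zero.2 (Function.surjInv_eq hf _)))
    have h2 := (homAdd g).map_sub (Function.surjInv hf (f.f c)) c
    exact sub_eq_zero.1 (h2.symm.trans h1)
  mkHom (fun d => g.f (Function.surjInv hf d)) fun r => by
    have h1 : r = map f.f (map (Function.surjInv hf) r) := by
      rw [map_map]; simp only [Function.surjInv_eq, map_id']
    conv_lhs => rw [h1, ← hom_act, key, hom_act, map_map]

theorem comp_desc {C D E : Contramodule R} (f : C ⟶ D) (hf : Function.Surjective f.f)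
    (g : C ⟶ E) (h : ∀ c, f.f c = 0 → g.f c = 0) : f ≫ desc f hf g h = g :=
  hom_ext fun c => by
    have h1 := h (Function.surjInv hf (f.f c) - c) (by
      have := (homAdd f).map_sub (Function.surjInv hf (f.f c)) c
      refine this.trans (sub_eq_zero.2 (Function.surjInv_eq hf _)))
    have h2 := (homAdd g).map_sub (Function.surjInv hf (f.f c)) c
    exact sub_eq_zero.1 (h2.symm.trans h1)

theorem epi_of_surjective {C D : Contramodule R} (f : C ⟶ D) (hf : Function.Surjective f.f) :
    Epi f where
  left_cancellation g h w := hom_ext fun d => by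
    obtain ⟨c, rfl⟩ := hf d
    exact ConcreteCategory.congr_hom (congrArg Monad.Algebra.Hom.f w) c

theorem cokerπ_surjective {C D : Contramodule R} (f : C ⟶ D) :
    Function.Surjective (cokerπ f).f := Quotient.mk_surjective

theorem surjective_of_epi {C D : Contramodule R} (f : C ⟶ D) [Epi f] :
    Function.Surjective f.f := fun d => by
  have h : cokerπ f = 0 := by rw [← cancel_epi f, comp_cokerπ, comp_zero]
  obtain ⟨c, hc⟩ := (cokerπ_eq_zero f d).1 (by rw [h]; rfl)
  exact ⟨c, hc⟩

theorem injective_of_mono {C D : Contramodule R} (f : C ⟶ D) [Mono f] :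
    Function.Injective f.f :=
  (mono_iff_injective _).1 (inferInstanceAs (Mono ((contraMonad R).forget.map f)))

instance : HasCokernels (Contramodule R) where
  has_colimit f := ⟨⟨⟨_, CokernelCofork.IsColimit.ofπ (cokerπ f) (comp_cokerπ f)
    (fun g hg => desc (cokerπ f) (cokerπ_surjective f) g fun d hd => by
      obtain ⟨c, rfl⟩ := (cokerπ_eq_zero f d).1 hd
      exact ConcreteCategory.congr_hom (congrArg Monad.Algebra.Hom.f hg) c)
    (fun g hg => comp_desc _ _ _ _)
    (fun g hg m hm => by
      have := epi_of_surjective _ (cokerπ_surjective f)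
      rw [← cancel_epi (cokerπ f), hm, comp_desc])⟩⟩⟩

instance : HasLimits (Contramodule R) :=
  ⟨fun _ => ⟨fun D => Monad.hasLimit_of_comp_forget_hasLimit D⟩⟩

instance : IsNormalMonoCategory (Contramodule R) where
  normalMonoOfMono {C D} f _ := ⟨⟨coker f, cokerπ f, comp_cokerπ f,
    have hf := injective_of_mono f
    have key : ∀ {W : Contramodule R} (g : W ⟶ D), g ≫ cokerπ f = 0 → ∀ w, ∃ c, f.f c = g.f w :=
      fun g hg w => (cokerπ_eq_zero f _).1
        (ConcreteCategory.congr_hom (congrArg Monad.Algebra.Hom.f hg) w)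
    KernelFork.IsLimit.ofι f (comp_cokerπ f)
      (fun {W} g hg => mkHom (fun w => (key g hg w).choose) fun r => hf (by
        rw [(key g hg _).choose_spec, hom_act, hom_act, map_map]
        congr 2
        exact funext fun w => (key g hg w).choose_spec.symm))
      (fun g hg => hom_ext fun w => (key g hg w).choose_spec)
      (fun g hg m hm => by rw [← cancel_mono f, hm]
                           exact (hom_ext fun w => (key g hg w).choose_spec).symm)⟩⟩

/-- The morphism `R[[X]] → C` extending a map `X → C`. -/
def freeLift {C : Contramodule R} {X : Type u} (g : X → C.A) : (contraMonad R).free.obj X ⟶ C :=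
  mkHom (C := (contraMonad R).free.obj X) (fun r => act C (map g r)) fun r =>
    (congrArg (act C) (map_bind g (r : convComb R (convComb R X)) id)).trans (act_bind C _ _)

theorem freeLift_point {C : Contramodule R} {X : Type u} (g : X → C.A) (x : X) :
    (freeLift g).f (point x : convComb R X) = g x :=
  (congrArg (act C) (map_point g x)).trans (act_point C _)

instance : IsNormalEpiCategory (Contramodule R) where
  normalEpiOfEpi {C D} f _ :=
    have w : freeLift (fun c : {c : C.A // f.f c = 0} => c.1) ≫ f = 0 := hom_ext fun r => by
      have key : ∀ r : convComb R {c : C.A // f.f c = 0},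
          f.f (act C (map (fun c => c.1) r)) = 0 := fun r => by
        rw [hom_act, map_map]
        exact (congrArg (fun g => act D (map g r)) (funext fun c => c.2)).trans (act_map_zero D r)
      exact key r
    ⟨⟨_, freeLift (fun c : {c : C.A // f.f c = 0} => c.1), w,
      CokernelCofork.IsColimit.ofπ f w
      (fun g hg => desc f (surjective_of_epi f) g fun c hc => by
        have := ConcreteCategory.congr_hom (congrArg Monad.Algebra.Hom.f hg)
          (point ⟨c, hc⟩ : convComb R {c : C.A // f.f c = 0})
        refine Eq.trans ?_ this
        exact congrArg g.f (freeLift_point (fun c : {c : C.A // f.f c = 0} => c.1) ⟨c, hc⟩).symm)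
      (fun g hg => comp_desc _ _ _ _)
      (fun g hg m hm => by rw [← cancel_epi f, hm, comp_desc])⟩⟩

instance : Abelian (Contramodule R) where

instance : EnoughProjectives (Contramodule R) where
  presentation C := ⟨{
    p := (contraMonad R).free.obj C.A
    f := freeLift id
    projective := by
      have : (contraMonad R).forget.PreservesEpimorphisms :=
        ⟨fun f _ => (epi_iff_surjective _).2 (surjective_of_epi f)⟩
      exact (contraMonad R).adj.map_projective _ inferInstance
    epi := epi_of_surjective _ fun c => ⟨(point c : convComb R C.A), freeLift_point _ _⟩ }⟩

/-! Discrete right modules and the contratensor product. -/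

variable (R) in
/-- A right `R`-module `N` (that is, a left module over the opposite ring) is discrete if the
annihilator of every element is open in `R`. -/
class IsDiscreteModule (N : Type u) [AddCommGroup N] [Module Rᵐᵒᵖ N] : Prop where
  isOpen_ann : ∀ b : N, IsOpen {r : R | MulOpposite.op r • b = 0}

variable (N : Type u) [AddCommGroup N] [Module Rᵐᵒᵖ N] [IsDiscreteModule R N]

theorem finite_support {X : Type*} (b : N) (r : convComb R X) :
    (Function.support fun x => MulOpposite.op (r.1 x) • b).Finite :=
  r.2 ((IsDiscreteModule.isOpen_ann b).mem_nhds (by simp))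

variable {N} in
/-- The finite formal linear combination `∑ (b r_x) x` in `N[X]`, for `b` in `N` and `∑ r_x x` in
`R[[X]]`. -/
def mulComb {X : Type*} (b : N) (r : convComb R X) : X →₀ N :=
  Finsupp.ofSupportFinite (fun x => MulOpposite.op (r.1 x) • b) (finite_support N b r)

variable {N} in
theorem mulComb_map {X Y : Type*} (f : X → Y) (b : N) (r : convComb R X) :
    mulComb b (map f r) = (mulComb b r).mapDomain f := by
  classical
  ext y
  let _ : TopologicalSpace N := ⊥
  have : DiscreteTopology N := ⟨rfl⟩
  let φ : R →+ N := AddMonoidHom.mk' (fun r => MulOpposite.op r • b) fun r s => by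
    simp [add_smul]
  have hφ : Continuous φ := continuous_of_continuousAt_zero φ <| by
    rw [ContinuousAt, map_zero, nhds_discrete N, tendsto_pure]
    exact (IsDiscreteModule.isOpen_ann b).mem_nhds (by simp)
  have h := (summable_of_tendsto r.2).subtype (f ⁻¹' {y})
  have h1 : φ ((map f r).1 y) = ∑' x : f ⁻¹' {y}, φ (r.1 x) := (h.map_tsum φ hφ)
  change φ ((map f r).1 y) = _
  rw [h1, tsum_subtype (f ⁻¹' {y}) fun x => φ (r.1 x), Finsupp.mapDomain, Finsupp.sum_apply,
    Finsupp.sum, tsum_eq_sum (s := (mulComb b r).support)]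
  · refine Finset.sum_congr rfl fun x _ => ?_
    by_cases hx : f x = y
    · subst hx; simp [φ]; rfl
    · simp [hx]
  · intro x hx
    have : φ (r.1 x) = 0 := Finsupp.notMem_support_iff.1 hx
    simp [Set.indicator, this]

open TensorProduct

/-- The subgroup of `N ⊗ C` generated by the elements `b ⊗ π(∑ r_c c) - ∑ (b r_c) ⊗ c`, which is
the image of the difference of the two maps from `N ⊗ R[[C]]` to `N ⊗ C`. -/
def contratensorRel (C : Contramodule R) : AddSubgroup (N ⊗[ℤ] C.A) :=
  AddSubgroup.closure {t | ∃ (b : N) (r : convComb R C.A),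
    t = b ⊗ₜ act C r - (mulComb b r).sum fun c n => n ⊗ₜ c}

/-- The contratensor product `N ⊙_R C`. -/
abbrev ContratensorProduct (C : Contramodule R) : Type u := (N ⊗[ℤ] C.A) ⧸ contratensorRel N C

/-- The map `N ⊙_R C → N ⊙_R D` induced by a morphism `C → D`, `b ⊗ c ↦ b ⊗ f c`. -/
def contratensorMap {C D : Contramodule R} (f : C ⟶ D) :
    ContratensorProduct N C →+ ContratensorProduct N D :=
  QuotientAddGroup.map _ _ ((homAdd f).toIntLinearMap.lTensor N).toAddMonoidHom <| by
    rw [contratensorRel, AddSubgroup.closure_le]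
    rintro _ ⟨b, r, rfl⟩
    refine AddSubgroup.subset_closure ⟨b, map f.f r, ?_⟩
    rw [mulComb_map, ← hom_act, Finsupp.sum_mapDomain_index (by simp)
      (by simp [TensorProduct.add_tmul])]
    change (homAdd f).toIntLinearMap.lTensor N _ = _
    rw [_root_.map_sub, Finsupp.sum, map_sum]
    rfl

theorem contratensorMap_mk {C D : Contramodule R} (f : C ⟶ D) (x : N ⊗[ℤ] C.A) :
    contratensorMap N f (x : ContratensorProduct N C) =
      ((homAdd f).toIntLinearMap.lTensor N x : N ⊗[ℤ] D.A) := rfl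

theorem contratensorMap_id (C : Contramodule R) :
    contratensorMap N (𝟙 C) = AddMonoidHom.id _ := by
  refine AddMonoidHom.ext fun x => ?_
  obtain ⟨x, rfl⟩ := QuotientAddGroup.mk_surjective x
  have : (homAdd (𝟙 C)).toIntLinearMap = LinearMap.id := rfl
  rw [contratensorMap_mk, this, LinearMap.lTensor_id]
  rfl

theorem contratensorMap_comp {C D E : Contramodule R} (f : C ⟶ D) (g : D ⟶ E) :
    contratensorMap N (f ≫ g) = (contratensorMap N g).comp (contratensorMap N f) := by
  refine AddMonoidHom.ext fun x => ?_
  obtain ⟨x, rfl⟩ := QuotientAddGroup.mk_surjective x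
  have : (homAdd (f ≫ g)).toIntLinearMap =
    (homAdd g).toIntLinearMap ∘ₗ (homAdd f).toIntLinearMap := rfl
  rw [contratensorMap_mk, this, LinearMap.lTensor_comp]
  rfl

theorem contratensorMap_add {C D : Contramodule R} (f g : C ⟶ D) :
    contratensorMap N (f + g) = contratensorMap N f + contratensorMap N g := by
  refine AddMonoidHom.ext fun x => ?_
  obtain ⟨x, rfl⟩ := QuotientAddGroup.mk_surjective x
  have : (homAdd (f + g)).toIntLinearMap =
    (homAdd f).toIntLinearMap + (homAdd g).toIntLinearMap := rfl
  rw [contratensorMap_mk, this, LinearMap.lTensor_add]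
  rfl

variable (R) in
/-- The functor of contratensor product `C ↦ N ⊙_R C`. -/
def contratensor : Contramodule R ⥤ AddCommGrpCat.{u} where
  obj C := AddCommGrpCat.of (ContratensorProduct N C)
  map f := AddCommGrpCat.ofHom (contratensorMap N f)
  map_id C := by rw [contratensorMap_id]; rfl
  map_comp f g := by rw [contratensorMap_comp]; rfl

instance : (contratensor R N).Additive where
  map_add {_ _ f g} := congrArg AddCommGrpCat.ofHom (contratensorMap_add N f g)

variable (R) in
/-- The left derived functors of the contratensor product, constructed by means of projective
resolutions of the contramodule argument. -/
def ctrtor (i : ℕ) : Contramodule R ⥤ AddCommGrpCat.{u} := (contratensor R N).leftDerived i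

/-- `n`-strict flatness: `Ctrtor_i(N, F) = 0` for all discrete right modules `N` and
`1 ≤ i ≤ n`. -/
def IsStrictlyFlat (n : ℕ) (F : Contramodule R) : Prop :=
  ∀ (N : Type u) [AddCommGroup N] [Module Rᵐᵒᵖ N] [IsDiscreteModule R N] (i : ℕ),
    1 ≤ i → i ≤ n → IsZero ((ctrtor R N i).obj F)

/-- `∞`-strict flatness: `n`-strict flatness for all `n > 0`. -/
def IsInftyStrictlyFlat (F : Contramodule R) : Prop := ∀ n, 0 < n → IsStrictlyFlat n F

variable (R) in
/-- The free contramodule with one generator, `R[[pt]] = R`. -/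
abbrev freeOne : Contramodule R := (contraMonad R).free.obj PUnit

/-- Right multiplication by `a`, as an endomorphism of the free contramodule `R`. -/
def mulRight (a : R) : freeOne R ⟶ freeOne R :=
  mkHom (C := freeOne R) (D := freeOne R)
    (fun r : convComb R PUnit => (⟨fun x => r.1 x * a, tendsto_mul_right r.2 _⟩ :
      convComb R PUnit)) fun r => by
    let m : convComb R PUnit.{u + 1} → convComb R PUnit.{u + 1} :=
      fun r => ⟨fun x => r.1 x * a, tendsto_mul_right r.2 _⟩
    have key : ∀ r : convComb R (convComb R PUnit), m (join r) = join (map m r) := fun r => by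
      rw [join_eq_bind (map m r), bind_map]
      ext x
      change (∑' y, r.1 y * y.1 x) * a = ∑' y, r.1 y * (y.1 x * a)
      simp_rw [← mul_assoc]
      exact (Summable.tsum_mul_right a (summable_of_tendsto
        (tendsto_mul_right r.2 fun y => y.1 x))).symm
    exact key r

/-- The sequence `R → R → R → ⋯` of right multiplications by `a 0, a 1, a 2, …`, whose direct limit
is the Bass flat contramodule associated with `a`. -/
def bassSequence (a : ℕ → R) : ℕ ⥤ Contramodule R :=
  Functor.ofSequence (X := fun _ => freeOne R) fun n => mulRight (a n)

end

end Contra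

/-!
A countable directed system has a cofinal sequence `P₀ ⟶ P₁ ⟶ ⋯`, whose colimit is the cokernel of
`id - shift : ∐ Pₙ ⟶ ∐ Pₙ`. A morphism into `∐ Pₙ` killed by `id - shift` has zero projections to
all the `Pₙ`, by induction on `n`. For free contramodules the projections separate the elements of
the coproduct, since they recover the coefficients; this passes to retracts, hence to projectives.
As contratensor products preserve coproducts, which are direct sums in abelian groups, the
projections also separate the elements of `N ⊙ ∐ Pₙ`. So `id - shift` is a projective resolution of
length one of the colimit, and it stays injective under `N ⊙ -`.
-/

namespace Contra

section TwoTermResolution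

open ZeroObject

variable {A B : Type*} [Category* A] [Abelian A] [Category* B] [Abelian B]

/-- The complex `⋯ ⟶ 0 ⟶ X ⟶ Y` with `Y` in degree `0`. -/
noncomputable def twoTermComplex {X Y : A} (f : X ⟶ Y) : ChainComplex A ℕ :=
  ChainComplex.mk' Y X f fun _ => ⟨0, 0, zero_comp⟩

theorem twoTermComplex_d {X Y : A} (f : X ⟶ Y) : (twoTermComplex f).d 1 0 = f :=
  ChainComplex.mk'_d_1_0 ..

theorem isZero_twoTermComplex_X {X Y : A} (f : X ⟶ Y) (n : ℕ) :
    IsZero ((twoTermComplex f).X (n + 2)) :=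
  (isZero_zero A).of_iso (ChainComplex.mk'XIso ..)

theorem exactAt_map_twoTermComplex (F : A ⥤ B) [F.Additive] {X Y : A} (f : X ⟶ Y)
    [Mono (F.map f)] (n : ℕ) :
    ((F.mapHomologicalComplex _).obj (twoTermComplex f)).ExactAt (n + 1) := by
  have h_zero (k : ℕ) : IsZero (((F.mapHomologicalComplex _).obj (twoTermComplex f)).X (k + 2)) :=
    F.map_isZero (isZero_twoTermComplex_X f k)
  match n with
  | 0 =>
    rw [HomologicalComplex.exactAt_iff' _ 2 1 0 (by simp) (by simp),
      ShortComplex.exact_iff_mono _ ((h_zero 0).eq_of_src _ _)]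
    change Mono (F.map ((twoTermComplex f).d 1 0))
    rwa [twoTermComplex_d]
  | n + 1 => exact ShortComplex.exact_of_isZero_X₂ _ (h_zero n)

/-- The augmentation of `⋯ ⟶ 0 ⟶ S.X₁ ⟶ S.X₂` by `S.g`, as a map to `S.X₃` in degree `0`. -/
noncomputable def twoTermAugmentation (S : ShortComplex A) :
    twoTermComplex S.f ⟶ (ChainComplex.single₀ A).obj S.X₃ :=
  (ChainComplex.toSingle₀Equiv _ _).symm
    ⟨S.g, (congrArg (· ≫ S.g) (twoTermComplex_d S.f)).trans S.zero⟩

theorem twoTermAugmentation_f_zero (S : ShortComplex A) : (twoTermAugmentation S).f 0 = S.g :=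
  ChainComplex.toSingle₀Equiv_symm_apply_f_zero ..

variable {S : ShortComplex A}

/-- A short exact sequence with projective first two terms, as a projective resolution of the
third. -/
noncomputable def twoTermResolution (hS : S.ShortExact) [Projective S.X₁] [Projective S.X₂] :
    ProjectiveResolution S.X₃ where
  complex := twoTermComplex S.f
  projective
    | 0 => ‹Projective S.X₂›
    | 1 => ‹Projective S.X₁›
    | n + 2 => (isZero_twoTermComplex_X S.f n).projective
  π := twoTermAugmentation S
  quasiIso := ⟨fun
    | 0 => by
      rw [ChainComplex.quasiIsoAt₀_iff, ShortComplex.quasiIso_iff_of_zeros' _ rfl rfl rfl]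
      refine (ShortComplex.exact_and_epi_g_iff_of_iso ?_).2 ⟨hS.exact, hS.epi_g⟩
      exact ShortComplex.isoMk (Iso.refl _) (Iso.refl _) (Iso.refl _)
        ((Category.id_comp _).trans ((twoTermComplex_d S.f).symm.trans (Category.comp_id _).symm))
        ((Category.id_comp _).trans
          ((twoTermAugmentation_f_zero S).symm.trans (Category.comp_id _).symm))
    | n + 1 => by
      have := hS.mono_f
      rw [quasiIsoAt_iff_exactAt' _ _ (ChainComplex.exactAt_succ_single_obj _ _)]
      exact exactAt_map_twoTermComplex (𝟭 A) S.f n⟩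

theorem isZero_leftDerived_of_shortExact (hS : S.ShortExact) [Projective S.X₁] [Projective S.X₂]
    [HasProjectiveResolutions A] (F : A ⥤ B) [F.Additive] [Mono (F.map S.f)] (n : ℕ) :
    IsZero ((F.leftDerived (n + 1)).obj S.X₃) :=
  ((HomologicalComplex.exactAt_iff_isZero_homology ..).1
    (exactAt_map_twoTermComplex F S.f n)).of_iso
      ((twoTermResolution hS).isoLeftDerivedObj F (n + 1))

end TwoTermResolution

theorem hasColimitsOfShape_of_faithful_rightAdjoint {J C D : Type*} [Category* J] [Category* C]
    [Category* D] [HasFiniteColimits D] [HasPullbacks D] [IsRegularEpiCategory D]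
    [HasColimitsOfShape J C] (U : D ⥤ C) [U.IsRightAdjoint] [U.Faithful] :
    HasColimitsOfShape J D := by
  let V := (Functor.whiskeringRight J D C).obj U
  have : V.IsRightAdjoint := ((Adjunction.ofIsRightAdjoint U).whiskerRight J).isRightAdjoint
  have : (Functor.const J : C ⥤ J ⥤ C).IsRightAdjoint :=
    hasColimitsOfShape_iff_isRightAdjoint_const.1 ‹_›
  rw [hasColimitsOfShape_iff_isRightAdjoint_const]
  exact isRightAdjoint_square_lift _ V U _ (Functor.compConstIso J U) fun X => regularEpiOfEpi _

-- Mathlib has this for index types in the universe of the morphisms only.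
theorem projective_sigma {A ι : Type*} [Category* A] (X : ι → A) [HasCoproduct X]
    [∀ i, Projective (X i)] : Projective (∐ X) where
  factors f e _ := ⟨Limits.Sigma.desc fun i => Projective.factorThru (Sigma.ι X i ≫ f) e, by
    ext i
    simp⟩

section SeparatedByProjections

variable {A B ι : Type*} [Category* A] [HasZeroMorphisms A] [Category* B] [HasZeroMorphisms B]
  [DecidableEq ι]

/-- The morphisms from `G.obj (∐ X)` to the `G.obj (X i)` induced by the projections are jointly
monic; between preadditive categories it suffices to ask this of pairs of the form `g`, `0`. -/
def SeparatedByProjections (G : A ⥤ B) (X : ι → A) [HasCoproduct X] : Prop :=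
  ∀ ⦃W : B⦄ (g : W ⟶ G.obj (∐ X)), (∀ i, g ≫ G.map (Sigma.π X i) = 0) → g = 0

theorem SeparatedByProjections.of_retract {G : A ⥤ B} {X Y : ι → A} [HasCoproduct X]
    [HasCoproduct Y] (hY : SeparatedByProjections G Y) (r : ∀ i, Retract (X i) (Y i)) :
    SeparatedByProjections G X := fun W g hg => by
  let s : ∐ X ⟶ ∐ Y := Limits.Sigma.map fun i => (r i).i
  let p : ∐ Y ⟶ ∐ X := Limits.Sigma.map fun i => (r i).r
  have h_split : s ≫ p = 𝟙 (∐ X) := by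
    ext i
    simp [s, p]
  have h_π (j : ι) : s ≫ Sigma.π Y j = Sigma.π X j ≫ (r j).i := by
    ext i
    obtain rfl | h := eq_or_ne i j <;> simp [s, Sigma.ι_π_of_ne_assoc, Sigma.ι_π_of_ne, *]
  have h_zero : g ≫ G.map s = 0 := hY _ fun i => by
    rw [Category.assoc, ← G.map_comp, h_π, G.map_comp, ← Category.assoc, hg, zero_comp]
  simpa [← G.map_comp, h_split] using congrArg (· ≫ G.map p) h_zero

end SeparatedByProjections

section Telescope

variable {A : Type*} [Category* A] [Preadditive A] (F : ℕ ⥤ A) [HasCoproduct F.obj]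

/-- The morphism `id - shift : ∐ₙ F n ⟶ ∐ₙ F n`, whose cokernel is the colimit of the sequence
`F`. -/
noncomputable def telescope : ∐ F.obj ⟶ ∐ F.obj :=
  Sigma.desc fun n => Sigma.ι F.obj n - F.map (homOfLE n.le_succ) ≫ Sigma.ι F.obj (n + 1)

theorem ι_telescope (n : ℕ) : Sigma.ι F.obj n ≫ telescope F =
    Sigma.ι F.obj n - F.map (homOfLE n.le_succ) ≫ Sigma.ι F.obj (n + 1) :=
  Sigma.ι_desc ..

theorem telescope_π_zero : telescope F ≫ Sigma.π F.obj 0 = Sigma.π F.obj 0 := by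
  ext n
  simp [telescope, Sigma.ι_π]

theorem telescope_π_succ (n : ℕ) : telescope F ≫ Sigma.π F.obj (n + 1) =
    Sigma.π F.obj (n + 1) - Sigma.π F.obj n ≫ F.map (homOfLE n.le_succ) := by
  ext m
  obtain rfl | h := eq_or_ne m n <;>
    simp [reassoc_of% ι_telescope, Sigma.ι_π, Sigma.ι_π_of_ne_assoc, *]

variable {F}

theorem telescope_comp_desc (c : Cocone F) : telescope F ≫ Sigma.desc c.ι.app = 0 := by
  ext n
  simp [telescope]

/-- The complex `∐ₙ F n ⟶ ∐ₙ F n ⟶ c.pt` formed by the telescope and the legs of a cocone. -/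
noncomputable def telescopeComplex (c : Cocone F) : ShortComplex A :=
  .mk (telescope F) (Sigma.desc c.ι.app) (telescope_comp_desc c)

/-- The colimit of a sequence is the cokernel of its telescope. -/
noncomputable def isColimitTelescopeCofork {c : Cocone F} (hc : IsColimit c) :
    IsColimit (CokernelCofork.ofπ (Sigma.desc c.ι.app) (telescope_comp_desc c)) := by
  have compat {Z : A} (g : ∐ F.obj ⟶ Z) (hg : telescope F ≫ g = 0) (n : ℕ) :
      F.map (homOfLE n.le_succ) ≫ Sigma.ι F.obj (n + 1) ≫ g = Sigma.ι F.obj n ≫ g := by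
    rw [eq_comm, ← sub_eq_zero, ← Category.assoc, ← Preadditive.sub_comp, ← ι_telescope,
      Category.assoc, hg, comp_zero]
  refine CokernelCofork.IsColimit.ofπ _ _
    (fun {Z} g hg => hc.desc ⟨Z, NatTrans.ofSequence (fun n => Sigma.ι F.obj n ≫ g) fun n =>
      (compat g hg n).trans (Category.comp_id _).symm⟩)
    (fun g hg => ?_) (fun g hg m hm => hc.hom_ext fun n => ?_)
  · ext n
    simp
  · simpa using congrArg (Sigma.ι F.obj n ≫ ·) hm

theorem mono_map_telescope {B : Type*} [Category* B] [Preadditive B] {G : A ⥤ B} [G.Additive]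
    (hF : SeparatedByProjections G F.obj) : Mono (G.map (telescope F)) :=
  Preadditive.mono_of_cancel_zero _ fun g hg => hF g fun n => by
    induction n with
    | zero => rw [← telescope_π_zero, G.map_comp, reassoc_of% hg, zero_comp]
    | succ n ih =>
      have h : g ≫ G.map (telescope F ≫ Sigma.π F.obj (n + 1)) = 0 := by
        rw [G.map_comp, reassoc_of% hg, zero_comp]
      simpa [telescope_π_succ, reassoc_of% ih] using h

end Telescope

section SequentialColimit

variable {A : Type*} [Category* A] [Abelian A] {F : ℕ ⥤ A} [HasCoproduct F.obj] {c : Cocone F}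

theorem shortExact_telescopeComplex (hc : IsColimit c)
    (hF : SeparatedByProjections (𝟭 A) F.obj) : (telescopeComplex c).ShortExact where
  exact := (telescopeComplex c).exact_of_g_is_cokernel (isColimitTelescopeCofork hc)
  mono_f := mono_map_telescope hF
  epi_g := Cofork.IsColimit.epi (isColimitTelescopeCofork hc)

variable [∀ n, Projective (F.obj n)]

instance : Projective (telescopeComplex c).X₁ := projective_sigma F.obj
instance : Projective (telescopeComplex c).X₂ := projective_sigma F.obj

theorem hasProjectiveDimensionLE_one_of_isColimit_sequence (hc : IsColimit c)
    (hF : SeparatedByProjections (𝟭 A) F.obj) : HasProjectiveDimensionLE c.pt 1 :=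
  (shortExact_telescopeComplex hc hF).hasProjectiveDimensionLT_X₃ 1 inferInstance inferInstance

theorem isZero_leftDerived_of_isColimit_sequence [HasProjectiveResolutions A] {B : Type*}
    [Category* B] [Abelian B] {G : A ⥤ B} [G.Additive] (hc : IsColimit c)
    (hF : SeparatedByProjections (𝟭 A) F.obj) (hG : SeparatedByProjections G F.obj) (n : ℕ) :
    IsZero ((G.leftDerived (n + 1)).obj c.pt) :=
  have : Mono (G.map (telescopeComplex c).f) := mono_map_telescope hG
  isZero_leftDerived_of_shortExact (shortExact_telescopeComplex hc hF) G n

end SequentialColimit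

noncomputable section

open TensorProduct

variable {R : Type u} [Ring R] [UniformSpace R] [IsUniformAddGroup R] [IsTopologicalRing R]
  [IsLinearTopology Rᵐᵒᵖ R] [CompleteSpace R] [T2Space R]

theorem hom_congr {C D : Contramodule R} {f g : C ⟶ D} (h : f = g) (c : C.A) : f.f c = g.f c :=
  ConcreteCategory.congr_hom (congrArg Monad.Algebra.Hom.f h) c

section Free

variable (R) in
/-- The free contramodule `R[[X]]`. -/
abbrev free (X : Type u) : Contramodule R := (contraMonad R).free.obj X

/-- The identification of the underlying group of the free contramodule with `R[[X]]`. Its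
additivity is not definitional, as addition on a contramodule is defined through the
contraaction. -/
def freeAddEquiv (X : Type u) : convComb R X ≃+ (free R X).A where
  __ := Equiv.refl _
  map_add' r s := by
    have h : bindHom id (point r + point s) = r + s := by
      rw [map_add, bindHom_point, bindHom_point, id, id]
    exact h.symm

/-- The element `1 · x` of the free contramodule `R[[X]]`. -/
def generator {X : Type u} (x : X) : (free R X).A := freeAddEquiv X (point x)

/-- The coefficient of `x` in a formal linear combination. -/
def coeff {X : Type u} (x : X) : (free R X).A →+ R :=
  (Pi.evalAddMonoidHom _ x).comp
    ((convComb R X).subtype.comp (freeAddEquiv X).symm.toAddMonoidHom)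

theorem coeff_generator_self {X : Type u} (x : X) : coeff x (generator x : (free R X).A) = 1 :=
  point_self x

theorem coeff_generator_of_ne {X : Type u} {x y : X} (h : y ≠ x) :
    coeff y (generator x : (free R X).A) = 0 :=
  point_ne h

theorem coeff_hom_act_map {C : Contramodule R} {X Y : Type u} (f : C ⟶ free R X) (g : Y → C.A)
    (r : convComb R Y) (x : X) :
    coeff x (f.f (act C (map g r))) = ∑' y, r.1 y * coeff x (f.f (g y)) := by
  have h : f.f (act C (map g r)) = bind r fun y => (f.f (g y) : convComb R X) := by
    rw [hom_act, map_map]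
    exact bind_map _ r id
  rw [h]
  rfl

theorem free_hom_ext {C : Contramodule R} {X : Type u} {f g : free R X ⟶ C}
    (h : ∀ x, f.f (generator x) = g.f (generator x)) : f = g :=
  ((contraMonad R).adj.homEquiv _ _).injective (ConcreteCategory.hom_ext _ _ h)

theorem freeLift_generator {C : Contramodule R} {X : Type u} (f : X → C.A) (x : X) :
    (freeLift f).f (generator x) = f x :=
  freeLift_point f x

theorem exists_act_map_val_eq {C : Contramodule R} (S : Set C.A)
    (hS : ∀ ⦃D : Contramodule R⦄ (f g : C ⟶ D), (∀ c ∈ S, f.f c = g.f c) → f = g) (c : C.A) :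
    ∃ r : convComb R S, act C (map Subtype.val r) = c := by
  have : Epi (freeLift (Subtype.val : S → C.A)) := ⟨fun f g hfg => hS f g fun c hc => by
    have : f.f ((freeLift Subtype.val).f (generator ⟨c, hc⟩)) =
        g.f ((freeLift Subtype.val).f (generator ⟨c, hc⟩)) := hom_congr hfg _
    rwa [freeLift_generator] at this⟩
  exact surjective_of_epi (freeLift Subtype.val) c

theorem projective_free (X : Type u) : Projective (free R X) := by
  have : (contraMonad R).forget.PreservesEpimorphisms :=
    ⟨fun f _ => (epi_iff_surjective _).2 (surjective_of_epi f)⟩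
  exact (contraMonad R).adj.map_projective X inferInstance

/-- A projective contramodule is a retract of the free contramodule on its underlying set. -/
def retractFree (P : Contramodule R) [Projective P] : Retract P (free R P.A) :=
  have := epi_of_surjective (freeLift (id : P.A → P.A)) fun c => ⟨_, freeLift_point id c⟩
  { i := Projective.factorThru (𝟙 P) (freeLift id)
    r := freeLift id
    retract := Projective.factorThru_comp .. }

end Free

instance hasColimitsOfShape (J : Type*) [Category* J] [Small.{u} J] :
    HasColimitsOfShape J (Contramodule R) :=
  hasColimitsOfShape_of_faithful_rightAdjoint (contraMonad R).forget

section CoproductOfFree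

variable {ι : Type*} (X : ι → Type u) [HasCoproduct fun i => free R (X i)]

/-- The generators of a coproduct of free contramodules. -/
def sigmaGenerator (p : Σ i, X i) : (∐ fun i => free R (X i)).A :=
  (Sigma.ι (fun i => free R (X i)) p.1).f (generator p.2)

theorem exists_act_map_sigmaGenerator_eq (c : (∐ fun i => free R (X i)).A) :
    ∃ r : convComb R (Set.range (sigmaGenerator (R := R) X)), act _ (map Subtype.val r) = c :=
  exists_act_map_val_eq _ (fun _ _ _ h => Sigma.hom_ext _ _ fun i =>
    free_hom_ext fun x => h _ (Set.mem_range_self (Sigma.mk i x))) c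

variable [DecidableEq ι]

theorem π_sigmaGenerator (i : ι) (x : X i) :
    (Sigma.π (fun i => free R (X i)) i).f (sigmaGenerator X ⟨i, x⟩) = generator x :=
  hom_congr (Sigma.ι_π_eq_id _ _) _

theorem π_sigmaGenerator_of_ne {i j : ι} (h : j ≠ i) (x : X j) :
    (Sigma.π (fun i => free R (X i)) i).f (sigmaGenerator X ⟨j, x⟩) = 0 :=
  hom_congr (Sigma.ι_π_of_ne _ h) _

theorem coeff_π_sigmaGenerator_self (p : Σ i, X i) :
    coeff p.2 ((Sigma.π (fun i => free R (X i)) p.1).f (sigmaGenerator X p)) = 1 := by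
  rw [π_sigmaGenerator, coeff_generator_self]

theorem coeff_π_sigmaGenerator_of_ne {p q : Σ i, X i} (h : q ≠ p) :
    coeff p.2 ((Sigma.π (fun i => free R (X i)) p.1).f (sigmaGenerator X q)) = 0 := by
  obtain ⟨i, x⟩ := p
  obtain ⟨j, y⟩ := q
  obtain rfl | hij := eq_or_ne j i
  · rw [π_sigmaGenerator]
    exact coeff_generator_of_ne fun hxy => h (congrArg _ hxy.symm)
  · rw [π_sigmaGenerator_of_ne X hij, map_zero]

theorem separatedByProjections_free :
    SeparatedByProjections (𝟭 (Contramodule R)) fun i => free R (X i) := by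
  intro W g hg
  refine hom_ext fun w => ?_
  obtain ⟨r, hr⟩ := exists_act_map_sigmaGenerator_eq X (g.f w)
  have h_zero : r = 0 := by
    ext ⟨_, ⟨p, rfl⟩⟩
    have h_coeff : coeff p.2 ((Sigma.π (fun i => free R (X i)) p.1).f (g.f w)) = 0 :=
      (congrArg (coeff p.2) (hom_congr (hg p.1) w)).trans (map_zero _)
    rw [← hr, coeff_hom_act_map, tsum_eq_single ⟨sigmaGenerator X p, p, rfl⟩,
      coeff_π_sigmaGenerator_self, mul_one] at h_coeff
    · exact h_coeff
    · rintro ⟨_, q, rfl⟩ hq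
      rw [coeff_π_sigmaGenerator_of_ne X fun h => hq (by rw [h]), mul_zero]
  rw [← hr, h_zero, map_hom_eq, map_zero, act_zero]
  rfl

theorem separatedByProjections_of_projective {ι : Type*} [DecidableEq ι] [Small.{u} ι]
    (P : ι → Contramodule R) [∀ i, Projective (P i)] :
    SeparatedByProjections (𝟭 (Contramodule R)) P :=
  (separatedByProjections_free fun i => (P i).A).of_retract fun i => retractFree (P i)

end CoproductOfFree

section Contratensor

variable (N : Type u) [AddCommGroup N] [Module Rᵐᵒᵖ N] [IsDiscreteModule R N]

variable {N} in
/-- The class `b ⊙ c` of a pure tensor in `N ⊙_R C`. -/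
def contraTmul {C : Contramodule R} (b : N) (c : C.A) : ContratensorProduct N C :=
  QuotientAddGroup.mk (b ⊗ₜ c)

theorem contraTmul_act_map {C : Contramodule R} {X : Type u} (b : N) (f : X → C.A)
    (r : convComb R X) :
    contraTmul b (act C (map f r)) = (mulComb b r).sum fun x n => contraTmul n (f x) := by
  have h_rel : contraTmul b (act C (map f r)) = QuotientAddGroup.mk' (contratensorRel N C)
      ((mulComb b (map f r)).sum fun c n => n ⊗ₜ c) :=
    QuotientAddGroup.eq_iff_sub_mem.2 (AddSubgroup.subset_closure ⟨b, map f r, rfl⟩)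
  rw [h_rel, mulComb_map, Finsupp.sum_mapDomain_index (by simp) (by simp [add_tmul]),
    map_finsuppSum]
  rfl

variable {N} in
theorem eq_top_of_contraTmul_mem {C : Contramodule R} {H : AddSubgroup (ContratensorProduct N C)}
    (h : ∀ b c, contraTmul b c ∈ H) : H = ⊤ := by
  refine (AddSubgroup.eq_top_iff' H).2 fun t => ?_
  obtain ⟨t, rfl⟩ := QuotientAddGroup.mk_surjective t
  induction t with
  | zero => exact H.zero_mem
  | tmul b c => exact h b c
  | add s t hs ht => exact H.add_mem hs ht

variable {ι : Type*} [DecidableEq ι] (C : ι → Contramodule R) [HasCoproduct C]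

theorem range_sumAddHom_contratensorMap_ι :
    (DFinsupp.sumAddHom fun i => contratensorMap N (Sigma.ι C i)).range = ⊤ := by
  refine eq_top_of_contraTmul_mem fun b c => ?_
  obtain ⟨r, rfl⟩ := exists_act_map_val_eq (⋃ i, Set.range (Sigma.ι C i).f) (fun D f g h =>
    Sigma.hom_ext _ _ fun i => hom_ext fun c => h _ (Set.mem_iUnion.2 ⟨i, c, rfl⟩)) c
  rw [contraTmul_act_map]
  refine AddSubgroup.sum_mem _ fun ⟨x, hx⟩ _ => ?_
  obtain ⟨i, c, rfl⟩ := Set.mem_iUnion.1 hx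
  exact ⟨DFinsupp.single i (contraTmul _ c), DFinsupp.sumAddHom_single ..⟩

theorem contratensorMap_π_sumAddHom (i : ι) (t : Π₀ i, ContratensorProduct N (C i)) :
    contratensorMap N (Sigma.π C i)
      (DFinsupp.sumAddHom (fun i => contratensorMap N (Sigma.ι C i)) t) = t i := by
  suffices (contratensorMap N (Sigma.π C i)).comp
      (DFinsupp.sumAddHom fun i => contratensorMap N (Sigma.ι C i)) =
        DFinsupp.evalAddMonoidHom i from DFunLike.congr_fun this t
  refine DFinsupp.addHom_ext fun j t => ?_
  rw [AddMonoidHom.comp_apply, DFinsupp.sumAddHom_single, ← AddMonoidHom.comp_apply,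
    ← contratensorMap_comp]
  obtain rfl | h := eq_or_ne j i
  · simp [contratensorMap_id, DFinsupp.evalAddMonoidHom]
  · have h_zero : contratensorMap N (0 : C j ⟶ C i) = 0 :=
      congrArg AddCommGrpCat.Hom.hom ((contratensor R N).map_zero _ _)
    simp [Sigma.ι_π_of_ne C h, h_zero, DFinsupp.evalAddMonoidHom,
      DFinsupp.single_eq_of_ne h.symm]

theorem separatedByProjections_contratensor : SeparatedByProjections (contratensor R N) C := by
  intro W g hg
  ext w
  obtain ⟨t, ht⟩ := (range_sumAddHom_contratensorMap_ι N C).symm ▸ AddSubgroup.mem_top (g w)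
  have h_zero : t = 0 := DFinsupp.ext fun i => by
    rw [← contratensorMap_π_sumAddHom, ht]
    exact ConcreteCategory.congr_hom (hg i) w
  rw [← ht, h_zero, map_zero]
  rfl

end Contratensor

section Colimits

variable {J : Type*} [Preorder J] [IsDirectedOrder J] [Nonempty J] [Countable J]
  {F : J ⥤ Contramodule R} [∀ j, Projective (F.obj j)] {c : Cocone F}

theorem hasProjectiveDimensionLE_one_of_isColimit (hc : IsColimit c) :
    HasProjectiveDimensionLE c.pt 1 :=
  let T := IsFiltered.sequentialFunctor J
  have (n : ℕ) : Projective ((T ⋙ F).obj n) := inferInstanceAs (Projective (F.obj (T.obj n)))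
  hasProjectiveDimensionLE_one_of_isColimit_sequence
    ((Functor.Final.isColimitWhiskerEquiv T c).symm hc)
    (separatedByProjections_of_projective (T ⋙ F).obj)

theorem isInftyStrictlyFlat_of_isColimit (hc : IsColimit c) : IsInftyStrictlyFlat c.pt := by
  intro _ _ N _ _ _ i hi _
  obtain ⟨i, rfl⟩ := Nat.exists_eq_add_of_le' hi
  let T := IsFiltered.sequentialFunctor J
  have (n : ℕ) : Projective ((T ⋙ F).obj n) := inferInstanceAs (Projective (F.obj (T.obj n)))
  exact isZero_leftDerived_of_isColimit_sequence
    ((Functor.Final.isColimitWhiskerEquiv T c).symm hc)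
    (separatedByProjections_of_projective (T ⋙ F).obj)
    (separatedByProjections_contratensor N (T ⋙ F).obj) i

end Colimits

end

end Contra

theorem corollary2p4 (R : Type u) [Ring R] [UniformSpace R] [IsUniformAddGroup R]
    [IsTopologicalRing R] [CompleteSpace R] [T2Space R]
    -- open right ideals form a base of neighborhoods of zero
    [IsLinearTopology Rᵐᵒᵖ R] :
    (∀ (J : Type w) [Preorder J] [IsDirectedOrder J] [Nonempty J] [Countable J]
      (F : J ⥤ Contra.Contramodule R), (∀ j, Projective (F.obj j)) →
      HasColimit F ∧
      ∀ (c : Cocone F), IsColimit c →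
        HasProjectiveDimensionLE c.pt 1 ∧ Contra.IsInftyStrictlyFlat c.pt) ∧
    (∀ a : ℕ → R,
      HasColimit (Contra.bassSequence a) ∧
      ∀ (c : Cocone (Contra.bassSequence a)), IsColimit c →
        HasProjectiveDimensionLE c.pt 1 ∧ Contra.IsInftyStrictlyFlat c.pt) := by
  refine ⟨fun J _ _ _ _ F _ => ⟨inferInstance, fun c hc => ?_⟩,
    fun a => ⟨inferInstance, fun c hc => ?_⟩⟩
  · exact ⟨Contra.hasProjectiveDimensionLE_one_of_isColimit hc,
      Contra.isInftyStrictlyFlat_of_isColimit hc⟩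
  · have (n : ℕ) : Projective ((Contra.bassSequence a).obj n) := Contra.projective_free _
    exact ⟨Contra.hasProjectiveDimensionLE_one_of_isColimit hc,
      Contra.isInftyStrictlyFlat_of_isColimit hc⟩
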